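/- **Weights.** For $S\ge 1$, a probability distribution $\mathcal W$ on $[0,\infty)$ is called $\mathrm{FiniteMgf}(S)$ if $\mathbf E[\mathcal W]=1$ and there is $\zeta>0$ with $\mathbf E[e^{\zeta \mathcal W}]<\infty$, $S\ge\max\{1,1/\zeta\}$, and $$\mathbf E\big[e^{\gamma\kappa \mathcal W}\big]\le 1+\gamma\kappa+S\gamma^2\kappa^2\qquad\text{for all }\gamma\in(0,\min\{\zeta/2,1\}),\ \kappa\in[-1,1].$$ **Process.** There are $n\ge 1$ bins, initially empty. Balls arrive in batches of $b$; the weights of the balls are independent samples from $\mathcal W$, independent of all other random choices. In the *$(1+\beta)$-process* with $\beta\in(0,1]$, every ball independently samples two bins $i_1,i_2$ independently and uniformly at random; with probability $\beta$ it is allocated to the one of $i_1,i_2$ that had the smaller load (total weight) at the beginning of the current batch, ties being broken by a fair coin flipped independently for each ball, and otherwise it is allocated to $i_1$. In the *version without random tie-breaking*, the bins are ranked by decreasing load at the beginning of each batch (the ranking stays fixed during the batch), and every ball of the batch is allocated, independently, to the bin of rank $i$ with probability $$p_i=(1-\beta)\cdot\frac1n+\beta\cdot\frac{2i-1}{n^2},\qquad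 i=1,\dots,n.$$ Let $\mathrm{Gap}(m)$ be the maximum load minus the average load of the $n$ bins after $m$ balls have been allocated. **Corollary.** There is an absolute constant $k>0$ such that the following holds. Let $n,b$ be natural numbers with $n\ge1$ and $b\ge n\log n$ (natural logarithm), let $S\in\big[1,\frac{b}{4n}\big]$, let $\mathcal W$ be a $\mathrm{FiniteMgf}(S)$ distribution, and let $\beta=\sqrt{4S\cdot\frac nb}$. Then for the $(1+\beta)$-process in the batched setting with batch size $b$ and weights from $\mathcal W$, both with and without random tie-breaking, and for every step $m\ge0$ that is a multiple of $b$, $$\Pr\left[\mathrm{Gap}(m)\le k\cdot\sqrt{\frac{Sb}{n}}\cdot\log n\right]\ge 1-n^{-2}.$$ -/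

import Mathlib

open MeasureTheory ProbabilityTheory

noncomputable section

namespace BatchedAlloc

/-- The measure on a finite type that gives the point `i` the mass `q i`. -/
def discreteLaw {ι : Type*} [Fintype ι] [MeasurableSpace ι] (q : ι → ℝ) : Measure ι :=
  ∑ i, ENNReal.ofReal (q i) • Measure.dirac i

/-- The weight distributions `FiniteMgf(S)`: probability distributions on `[0, ∞)` of mean one
with `E[exp (ζ W)] < ∞` for some `ζ > 0`, where `S ≥ max {1, 1/ζ}` is a constant for which the
moment generating function has the quadratic bound below
(all exponentials in it are integrable because `γ κ < ζ`). -/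
structure FiniteMgf (S : ℝ) (W : Measure ℝ) : Prop where
  isProbabilityMeasure : IsProbabilityMeasure W
  nonneg : ∀ᵐ w ∂W, 0 ≤ w
  mean : ∫ w, w ∂W = 1
  mgf : ∃ ζ : ℝ, 0 < ζ ∧ Integrable (fun w => Real.exp (ζ * w)) W ∧ max 1 (1 / ζ) ≤ S ∧
    ∀ γ κ : ℝ, 0 < γ → γ < min (ζ / 2) 1 → -1 ≤ κ → κ ≤ 1 →
      ∫ w, Real.exp (γ * κ * w) ∂W ≤ 1 + γ * κ + S * γ ^ 2 * κ ^ 2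

/-- The gap of a load vector: maximum load minus average load. -/
def gap {n : ℕ} (x : Fin n → ℝ) : ℝ := (⨆ i, x i) - (∑ i, x i) / n

/-! ### The `(1 + β)`-process in the weighted batched setting, with random tie-breaking -/

/-- The randomness of one ball: the two sampled bins, the coin that decides between two choices
(`true`) and one choice (`false`), the coin that breaks a tie, and the weight. -/
abbrev Ball (n : ℕ) : Type := Fin n × Fin n × Bool × Bool × ℝ

/-- The law of the randomness of one ball: all five components are independent, the bins are
uniform, the first coin shows `true` with probability `β`, the tie coin is fair, and the weight
has law `W`. -/
def ballLaw (n : ℕ) (β : ℝ) (W : Measure ℝ) : Measure (Ball n) :=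
  (discreteLaw fun _ : Fin n => 1 / (n : ℝ)).prod
    ((discreteLaw fun _ : Fin n => 1 / (n : ℝ)).prod
      ((discreteLaw fun c : Bool => if c then β else 1 - β).prod
        ((discreteLaw fun _ : Bool => (1 / 2 : ℝ)).prod W)))

/-- The bin that a ball is allocated to when the reported loads are `x`. -/
def chosenBin {n : ℕ} (x : Fin n → ℝ) : Ball n → Fin n
  | (i₁, i₂, twoChoices, tie, _) =>
    if twoChoices then
      if x i₁ < x i₂ then i₁
      else if x i₂ < x i₁ then i₂
      else if tie then i₁ else i₂
    else i₁

/-- The weight of a ball. -/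
def Ball.weight {n : ℕ} (a : Ball n) : ℝ := a.2.2.2.2

/-- The load vector after `r` batches of `b` balls, that is, at step `m = r * b`. Every ball of a
batch is allocated according to the loads at the beginning of that batch. -/
def load {n : ℕ} (b : ℕ) (a : ℕ → Ball n) : ℕ → Fin n → ℝ
  | 0 => fun _ => 0
  | r + 1 => fun i => load b a r i +
      ∑ j ∈ Finset.range b,
        if chosenBin (load b a r) (a (r * b + j)) = i then (a (r * b + j)).weight else 0

/-! ### The weighted batched setting given by a probability allocation vector -/

/-- The probability allocation vector of the `(1 + β)`-process,
`p_i = (1 - β) / n + β (2 i - 1) / n²` for `i = 1, …, n`; the index in `Fin n` starts at zero. -/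
def onePlusBetaVec (n : ℕ) (β : ℝ) (i : Fin n) : ℝ :=
  (1 - β) * (1 / (n : ℝ)) + β * ((2 * ((i : ℝ) + 1) - 1) / (n : ℝ) ^ 2)

/-- The vector `z` sorted decreasingly. -/
def sortDesc {n : ℕ} (z : Fin n → ℝ) : Fin n → ℝ := fun i => z (Tuple.sort z i.rev)

/-- The normalized and decreasingly sorted load vector after `r` batches of `b` balls, when the
`s`-th ball goes to the bin of rank `(a s).1` (with rank `0` for the heaviest bin at the beginning
of the batch) and has weight `(a s).2`. -/
def sortedLoad {n : ℕ} (b : ℕ) (a : ℕ → Fin n × ℝ) : ℕ → Fin n → ℝ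
  | 0 => fun _ => 0
  | r + 1 => sortDesc fun i => sortedLoad b a r i
      + (∑ j ∈ Finset.range b, if (a (r * b + j)).1 = i then (a (r * b + j)).2 else 0)
      - 1 / (n : ℝ) * ∑ j ∈ Finset.range b, (a (r * b + j)).2

end BatchedAlloc

end

noncomputable section

namespace BatchedAlloc


/-! The proof tracks the potential `Φ = ∑ i, 2 cosh (γ (x i - average))` from batch to batch and
ends with Markov's inequality.

In both versions, a ball of a batch goes to bin `i` with probability `(1 + β * bias f i) / n`. Here
`f` orders the bins consistently with their loads: `f` is the load itself under random tie-breaking,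
and minus the rank otherwise. During a batch these probabilities are frozen and the balls are
independent, so the moment generating function of a normalized load change is controlled by the
`b`-th power of a one-ball bound. With `γ` proportional to `β / S`, a batch multiplies `exp (± z
i)`, where `z i` is `γ` times the normalized load, by at most `exp (± θ * bias f i + η)` in
expectation, with `θ = 1/36` and `η ≤ θ ^ 2` (`AllocLaw.lintegral_exp_le`, `lintegral_exp_sum_le`).

To first order, the change of `Φ` is `θ * ∑ i, 2 sinh (z i) * bias f i`. Symmetrizing over pairs of
bins (`sum_mul_bias`) turns this sum into minus the mean pairwise distance of the hyperbolic sines.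
A median argument (`potential_le_sum_abs_sub`) shows that this distance is of order `Φ`, up to
`O(n)`. Hence one batch contracts `Φ` by a constant factor, up to an additive `O(n)`
(`lintegral_potential_le`). As a batch is independent of the past, `E Φ ≤ 10 n` at all times
(`lintegral_chain_le`). A large gap forces `Φ` to be exponentially large, which gives the tail bound
in `one_sub_le_gap_le`. -/

/-! ### The drift of the hyperbolic cosine potential -/

/-- Every finite real family has a median. -/
theorem exists_median {n : ℕ} (hn : 0 < n) (z : Fin n → ℝ) :
    ∃ m : Fin n, n ≤ 2 * (Finset.univ.filter fun i => z i ≤ z m).card ∧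
      n ≤ 2 * (Finset.univ.filter fun i => z m ≤ z i).card := by
  let σ := Tuple.sort z
  have hmono : Monotone (z ∘ σ) := Tuple.monotone_sort z
  let k : Fin n := ⟨n / 2, by omega⟩
  refine ⟨σ k, ?_, ?_⟩
  · have h : (Finset.Iic k).map σ.toEmbedding ⊆ Finset.univ.filter fun i => z i ≤ z (σ k) := by
      intro i hi
      simp only [Finset.mem_map, Finset.mem_Iic] at hi
      obtain ⟨j, hj, rfl⟩ := hi
      simpa using hmono hj
    have := Finset.card_le_card h
    rw [Finset.card_map, Fin.card_Iic] at this
    have hk : (k : ℕ) = n / 2 := rfl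
    omega
  · have h : (Finset.Ici k).map σ.toEmbedding ⊆ Finset.univ.filter fun i => z (σ k) ≤ z i := by
      intro i hi
      simp only [Finset.mem_map, Finset.mem_Ici] at hi
      obtain ⟨j, hj, rfl⟩ := hi
      simpa using hmono hj
    have := Finset.card_le_card h
    rw [Finset.card_map, Fin.card_Ici] at this
    have hk : (k : ℕ) = n / 2 := rfl
    omega

/-- If `m` lies between `s i` and `s j`, their distance splits into the two distances to `m`, and
every `i` has at least `n / 2` such partners `j`. In `opp` the condition on `s j` is weak, so that
both median hypotheses apply; a value equal to `m` contributes zero anyway. -/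
theorem sum_abs_sub_median_le {n : ℕ} (s : Fin n → ℝ) (m : ℝ)
    (h₁ : n ≤ 2 * (Finset.univ.filter fun i => s i ≤ m).card)
    (h₂ : n ≤ 2 * (Finset.univ.filter fun i => m ≤ s i).card) :
    n * ∑ i, |s i - m| ≤ ∑ i, ∑ j, |s i - s j| := by
  let opp : Fin n → Fin n → Prop := fun i j => (s i < m ∧ m ≤ s j) ∨ (m ≤ s i ∧ s j ≤ m)
  classical
  have hle : ∀ i, (n : ℝ) / 2 * |s i - m| ≤ ∑ j, if opp i j then |s i - m| else 0 := by
    intro i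
    rw [← Finset.sum_filter, Finset.sum_const, nsmul_eq_mul]
    refine mul_le_mul_of_nonneg_right ?_ (abs_nonneg _)
    rw [div_le_iff₀ (by norm_num)]
    rcases lt_or_ge (s i) m with hi | hi
    · have : (Finset.univ.filter fun j => m ≤ s j) ⊆ Finset.univ.filter fun j => opp i j :=
        Finset.monotone_filter_right _ fun j _ hj => Or.inl ⟨hi, hj⟩
      have := Finset.card_le_card this
      exact_mod_cast (by omega : n ≤ _ * 2)
    · have : (Finset.univ.filter fun j => s j ≤ m) ⊆ Finset.univ.filter fun j => opp i j :=
        Finset.monotone_filter_right _ fun j _ hj => Or.inr ⟨hi, hj⟩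
      have := Finset.card_le_card this
      exact_mod_cast (by omega : n ≤ _ * 2)
  have hpt : ∀ i j, (if opp i j then |s i - m| else 0) + (if opp j i then |s j - m| else 0) ≤
      |s i - s j| := by
    intro i j
    simp only [opp]
    rcases abs_cases (s i - m) with ⟨h1, h1'⟩ | ⟨h1, h1'⟩ <;>
    rcases abs_cases (s j - m) with ⟨h2, h2'⟩ | ⟨h2, h2'⟩ <;>
    rcases abs_cases (s i - s j) with ⟨h3, h3'⟩ | ⟨h3, h3'⟩ <;>
    rw [h1, h2, h3] <;> split_ifs <;> grind
  have hsum := Finset.sum_le_sum fun i (_ : i ∈ Finset.univ) =>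
    Finset.sum_le_sum fun j (_ : j ∈ Finset.univ) => hpt i j
  simp only [Finset.sum_add_distrib] at hsum
  rw [Finset.sum_comm (f := fun i j => if opp j i then |s j - m| else 0)] at hsum
  have h := Finset.sum_le_sum fun i (_ : i ∈ Finset.univ) => hle i
  rw [← Finset.mul_sum] at h
  linarith

/-- If at least half of the numbers `z i` are at most `-L`, then the other ones have to compensate
for it, as the sum vanishes; by convexity this makes the sum of the exponentials large. -/
theorem sum_pos_exp_ge {n : ℕ} (z : Fin n → ℝ) (hz : ∑ i, z i = 0) {L : ℝ} (hL : 1 ≤ L)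
    (h : n ≤ 2 * (Finset.univ.filter fun i => z i ≤ -L).card) :
    n / 2 * Real.exp L ≤ ∑ i ∈ Finset.univ.filter (fun i => 0 < z i), Real.exp (z i) := by
  set A := Finset.univ.filter fun i => z i ≤ -L with hA
  set B := Finset.univ.filter fun i => 0 < z i with hB
  have hdisj : Disjoint A B := by
    rw [Finset.disjoint_left]
    intro i hi hi'
    simp [hA, hB] at hi hi'
    linarith
  have hcard : A.card + B.card ≤ n := by
    rw [← Finset.card_union_of_disjoint hdisj]
    simpa using Finset.card_le_univ (A ∪ B)
  have hAn : (n : ℝ) ≤ 2 * A.card := by exact_mod_cast h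
  have hBn : (2 * B.card : ℝ) ≤ n := by exact_mod_cast (by omega : 2 * B.card ≤ n)
  have hsumA : ∑ i ∈ A, z i ≤ A.card * (-L) := by
    rw [← nsmul_eq_mul]
    exact Finset.sum_le_card_nsmul _ _ _ fun i hi => (Finset.mem_filter.1 hi).2
  have hsumB : A.card * L ≤ ∑ i ∈ B, z i := by
    have h1 : ∑ i ∈ A, z i + ∑ i ∈ B, z i = ∑ i ∈ A ∪ B, z i :=
      (Finset.sum_union hdisj).symm
    have h2 : ∑ i ∈ A ∪ B, z i + ∑ i ∈ (A ∪ B)ᶜ, z i = 0 := by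
      rw [Finset.sum_add_sum_compl, hz]
    have h3 : ∑ i ∈ (A ∪ B)ᶜ, z i ≤ 0 := by
      refine Finset.sum_nonpos fun i hi => ?_
      simp [hA, hB] at hi
      exact hi.2
    linarith
  -- The tangent to `exp` at `L`. Summed over `B`, it gives the claim because `B.card ≤ n / 2 ≤
  -- A.card` and `1 ≤ L`.
  have htan : ∀ i ∈ B, Real.exp L * (1 + z i - L) ≤ Real.exp (z i) := by
    intro i _
    have h1 := Real.add_one_le_exp (z i - L)
    have h2 : Real.exp (z i) = Real.exp L * Real.exp (z i - L) := by
      rw [← Real.exp_add]; ring_nf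
    rw [h2]
    exact mul_le_mul_of_nonneg_left (by linarith) (Real.exp_pos _).le
  have hs := Finset.sum_le_sum htan
  rw [← Finset.mul_sum] at hs
  simp only [Finset.sum_sub_distrib, Finset.sum_add_distrib, Finset.sum_const, nsmul_eq_mul,
    mul_one] at hs
  refine le_trans ?_ hs
  rw [mul_comm]
  refine mul_le_mul_of_nonneg_left ?_ (Real.exp_pos _).le
  nlinarith

/-- Recentring from `2 sinh a` to `0` costs at most `n * exp (-a)`. For `-a ≤ 1` this is at most `3
n`. Otherwise `sum_pos_exp_ge` bounds it by twice the sum of `exp (z i)` over positive `z i`, and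
each of these terms exceeds its distance to `2 sinh a` by at most `1`. -/
theorem sum_abs_sinh_le {n : ℕ} (z : Fin n → ℝ) (hz : ∑ i, z i = 0) {a : ℝ} (ha : a ≤ 0)
    (h : n ≤ 2 * (Finset.univ.filter fun i => z i ≤ a).card) :
    ∑ i, |2 * Real.sinh (z i)| - 3 * n ≤ 3 * ∑ i, |2 * Real.sinh (z i) - 2 * Real.sinh a| := by
  have hsa : Real.sinh a ≤ 0 := Real.sinh_nonpos_iff.2 ha
  have htri : ∑ i, |2 * Real.sinh (z i)| ≤
      ∑ i, |2 * Real.sinh (z i) - 2 * Real.sinh a| + n * (-(2 * Real.sinh a)) := by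
    have : ∀ i, |2 * Real.sinh (z i)| ≤
        |2 * Real.sinh (z i) - 2 * Real.sinh a| + (-(2 * Real.sinh a)) := by
      intro i
      have h1 := abs_add_le (2 * Real.sinh (z i) - 2 * Real.sinh a) (2 * Real.sinh a)
      rw [abs_of_nonpos (show 2 * Real.sinh a ≤ 0 by linarith), sub_add_cancel] at h1
      exact h1
    refine (Finset.sum_le_sum fun i _ => this i).trans_eq ?_
    simp [Finset.sum_add_distrib]
  have hnn : 0 ≤ ∑ i, |2 * Real.sinh (z i) - 2 * Real.sinh a| :=
    Finset.sum_nonneg fun i _ => abs_nonneg _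
  have hn0 : (0 : ℝ) ≤ n := Nat.cast_nonneg n
  have he : -(2 * Real.sinh a) ≤ Real.exp (-a) := by
    rw [Real.sinh_eq]
    have := Real.exp_pos a
    linarith
  rcases le_or_gt (-a) 1 with h1 | h1
  · have he1 : Real.exp (-a) ≤ 3 := by
      refine (Real.exp_le_exp.2 h1).trans ?_
      have := Real.exp_one_lt_d9
      linarith
    nlinarith
  · have hexp := sum_pos_exp_ge z hz h1.le (by simpa using h)
    have hB : ∑ i ∈ Finset.univ.filter (fun i => 0 < z i), (Real.exp (z i) - 1) ≤
        ∑ i, |2 * Real.sinh (z i) - 2 * Real.sinh a| := by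
      refine (Finset.sum_le_sum fun i hi => ?_).trans
        (Finset.sum_le_sum_of_subset_of_nonneg (Finset.filter_subset _ _)
          fun i _ _ => abs_nonneg _)
      have hzi : 0 < z i := (Finset.mem_filter.1 hi).2
      refine le_trans ?_ (le_abs_self _)
      rw [Real.sinh_eq]
      have : Real.exp (-z i) ≤ 1 := Real.exp_le_one_iff.2 (by linarith)
      linarith
    rw [Finset.sum_sub_distrib, Finset.sum_const, nsmul_eq_mul, mul_one] at hB
    have hcard : ((Finset.univ.filter fun i => 0 < z i).card : ℝ) ≤ n := by
      exact_mod_cast (by simpa using Finset.card_le_univ (Finset.univ.filter fun i => 0 < z i))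
    nlinarith

/-- The total pairwise difference of the hyperbolic sines of numbers with sum zero is at least a
constant proportion of the hyperbolic cosine potential, up to an additive term. -/
theorem potential_le_sum_abs_sub {n : ℕ} (z : Fin n → ℝ) (hz : ∑ i, z i = 0) :
    n / 3 * (∑ i, 2 * Real.cosh (z i) - 5 * n) ≤
      ∑ i, ∑ j, |2 * Real.sinh (z i) - 2 * Real.sinh (z j)| := by
  rcases Nat.eq_zero_or_pos n with rfl | hn
  · simp
  have key : ∃ m : Fin n, ∑ i, |2 * Real.sinh (z i)| - 3 * n ≤
      3 * ∑ i, |2 * Real.sinh (z i) - 2 * Real.sinh (z m)| ∧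
      n ≤ 2 * (Finset.univ.filter fun i => z i ≤ z m).card ∧
      n ≤ 2 * (Finset.univ.filter fun i => z m ≤ z i).card := by
    obtain ⟨m, h1, h2⟩ := exists_median hn z
    refine ⟨m, ?_, h1, h2⟩
    rcases le_total (z m) 0 with hm | hm
    · exact sum_abs_sinh_le z hz hm h1
    · have := sum_abs_sinh_le (fun i => -z i) (by simp [hz]) (a := -z m) (by linarith)
        (by simpa using h2)
      simp only [Real.sinh_neg, mul_neg, abs_neg] at this
      refine this.trans_eq ?_
      congr 1
      refine Finset.sum_congr rfl fun i _ => ?_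
      rw [← abs_neg]
      congr 1
      ring
  obtain ⟨m, hm, h1, h2⟩ := key
  have hs := sum_abs_sub_median_le (fun i => 2 * Real.sinh (z i)) (2 * Real.sinh (z m))
    (by simpa using h1) (by simpa using h2)
  refine le_trans ?_ hs
  -- The `2 n` lost here and the `3 n` of `sum_abs_sinh_le` make up the `5 n` of the statement.
  have hcosh : ∑ i, 2 * Real.cosh (z i) ≤ ∑ i, |2 * Real.sinh (z i)| + 2 * n := by
    have : ∀ i, 2 * Real.cosh (z i) ≤ |2 * Real.sinh (z i)| + 2 := by
      intro i
      rw [abs_mul, Real.cosh_eq, Real.sinh_eq, abs_of_pos (by norm_num : (0 : ℝ) < 2)]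
      rcases le_total 0 (z i) with h | h
      · have h3 : Real.exp (-z i) ≤ 1 := Real.exp_le_one_iff.2 (by linarith)
        have := le_abs_self ((Real.exp (z i) - Real.exp (-z i)) / 2)
        linarith
      · have h3 : Real.exp (z i) ≤ 1 := Real.exp_le_one_iff.2 (by linarith)
        have := neg_abs_le ((Real.exp (z i) - Real.exp (-z i)) / 2)
        linarith
    refine (Finset.sum_le_sum fun i _ => this i).trans_eq ?_
    simp [Finset.sum_add_distrib, mul_comm]
  have hn0 : (0 : ℝ) ≤ n := Nat.cast_nonneg n
  nlinarith

/-- The relative bias of bin `i`, when `f` is compared between the bins: the proportion of bins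
with a larger value minus the proportion of bins with a smaller value. -/
def bias {n : ℕ} (f : Fin n → ℝ) (i : Fin n) : ℝ :=
  (∑ j, (SignType.sign (f j - f i) : ℝ)) / n

theorem abs_sign_le_one (x : ℝ) : |((SignType.sign x : SignType) : ℝ)| ≤ 1 := by
  rcases lt_trichotomy x 0 with h | h | h <;> simp [h]

theorem abs_bias_le_one {n : ℕ} (f : Fin n → ℝ) (i : Fin n) : |bias f i| ≤ 1 := by
  rw [bias, abs_div, Nat.abs_cast]
  refine div_le_one_of_le₀ ((Finset.abs_sum_le_sum_abs _ _).trans ?_) (Nat.cast_nonneg n)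
  exact (Finset.sum_le_sum fun j _ => abs_sign_le_one _).trans (by simp)

/-- The sign is antisymmetric in `i` and `j`, so the double sum can be averaged with its transpose;
monotonicity of `s` in `f` then gives `(s i - s j) * sign (f j - f i) = -|s i - s j|`. -/
theorem sum_mul_bias {n : ℕ} (f s : Fin n → ℝ)
    (h : ∀ i j, f i < f j → s i ≤ s j) (h' : ∀ i j, f i = f j → s i = s j) :
    n * ∑ i, s i * bias f i = -(∑ i, ∑ j, |s i - s j|) / 2 := by
  rcases Nat.eq_zero_or_pos n with rfl | hn
  · simp
  have hn' : (n : ℝ) ≠ 0 := by positivity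
  have h1 : n * ∑ i, s i * bias f i = ∑ i, ∑ j, s i * (SignType.sign (f j - f i) : ℝ) := by
    rw [Finset.mul_sum]
    refine Finset.sum_congr rfl fun i _ => ?_
    rw [bias, ← Finset.mul_sum]
    field_simp
  have h2 : ∑ i, ∑ j, s i * (SignType.sign (f j - f i) : ℝ) =
      ∑ i, ∑ j, -(s j * (SignType.sign (f j - f i) : ℝ)) := by
    rw [Finset.sum_comm]
    refine Finset.sum_congr rfl fun i _ => Finset.sum_congr rfl fun j _ => ?_
    rw [← neg_sub (f j) (f i), Left.sign_neg]
    simp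
  have h3 : ∀ i j, |s i - s j| = -(s i * (SignType.sign (f j - f i) : ℝ)) -
      (-(s j * (SignType.sign (f j - f i) : ℝ))) := by
    intro i j
    rcases lt_trichotomy (f i) (f j) with hij | hij | hij
    · rw [sign_pos (sub_pos.2 hij), abs_of_nonpos (sub_nonpos.2 (h i j hij))]
      simp; ring
    · simp [hij, h' i j hij]
    · rw [sign_neg (sub_neg.2 hij), abs_of_nonneg (sub_nonneg.2 (h j i hij))]
      simp
  simp only [h3, Finset.sum_sub_distrib]
  rw [← h2, h1]
  simp only [Finset.sum_neg_distrib]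
  ring

/-- The expected drift in the direction of the bias. -/
theorem sum_sinh_mul_bias_le {n : ℕ} (hn : 0 < n) (f z : Fin n → ℝ) (hz : ∑ i, z i = 0)
    (h : ∀ i j, f i < f j → z i ≤ z j) (h' : ∀ i j, f i = f j → z i = z j) :
    ∑ i, 2 * Real.sinh (z i) * bias f i ≤ -(∑ i, 2 * Real.cosh (z i) - 5 * n) / 6 := by
  have h1 := sum_mul_bias f (fun i => 2 * Real.sinh (z i))
    (fun i j hij => by simpa using h i j hij) (fun i j hij => by simp [h' i j hij])
  have h2 := potential_le_sum_abs_sub z hz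
  have hn' : (0 : ℝ) < n := by positivity
  refine le_of_mul_le_mul_left ?_ hn'
  rw [h1]
  linarith


/-! ### The expected change of the potential over one batch -/

/-- As `S ≥ max 1 (1 / ζ)`, the single condition `γ < 1 / (2 * S)` implies both restrictions on `γ`,
so `ζ` disappears from here on. -/
theorem FiniteMgf.lintegral_exp_le {S : ℝ} {W : Measure ℝ} (hW : FiniteMgf S W) {γ κ : ℝ}
    (hγ : 0 < γ) (hγS : γ < 1 / (2 * S)) (hκ : |κ| ≤ 1) :
    ∫⁻ w, ENNReal.ofReal (Real.exp (γ * κ * w)) ∂W ≤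
      ENNReal.ofReal (1 + γ * κ + S * γ ^ 2 * κ ^ 2) := by
  have := hW.isProbabilityMeasure
  obtain ⟨ζ, hζ, hint, hS, hmgf⟩ := hW.mgf
  have hS1 : 1 ≤ S := (le_max_left _ _).trans hS
  have hζS : 1 / S ≤ ζ := by
    rw [one_div_le (by linarith) hζ]
    exact (le_max_right _ _).trans hS
  have hγζ : γ < ζ / 2 := by
    refine hγS.trans_le ?_
    rw [one_div, mul_inv, ← one_div, ← one_div]
    linarith
  have hγ1 : γ < 1 := by
    refine hγS.trans_le ?_
    rw [div_le_one (by linarith)]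
    linarith
  obtain ⟨hκ1, hκ2⟩ := abs_le.1 hκ
  have hint' : Integrable (fun w => Real.exp (γ * κ * w)) W := by
    refine (hint.add (integrable_const (1 : ℝ))).mono' (by fun_prop) ?_
    filter_upwards [hW.nonneg] with w hw
    rw [Real.norm_eq_abs, abs_of_pos (Real.exp_pos _), Pi.add_apply]
    have h1 : γ * κ * w ≤ ζ * w := mul_le_mul_of_nonneg_right (by nlinarith) hw
    linarith [Real.exp_le_exp.2 h1]
  rw [← ofReal_integral_eq_lintegral_ofReal hint' (ae_of_all _ fun w => (Real.exp_pos _).le)]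
  exact ENNReal.ofReal_le_ofReal (hmgf γ κ hγ (lt_min hγζ hγ1) hκ1 hκ2)

/-- Under `μ`, the bin `c` has law `p` and the weight `w` is independent of it with law `W`. -/
def AllocLaw {n : ℕ} {E : Type*} [MeasurableSpace E] (c : E → Fin n) (w : E → ℝ) (μ : Measure E)
    (p : Fin n → ℝ) (W : Measure ℝ) : Prop :=
  ∀ F : Fin n → ℝ → ENNReal, (∀ i, Measurable (F i)) →
    ∫⁻ e, F (c e) (w e) ∂μ = ∑ i, ENNReal.ofReal (p i) * ∫⁻ v, F i v ∂W

theorem sum_bias {n : ℕ} (f : Fin n → ℝ) : ∑ i, bias f i = 0 := by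
  rcases Nat.eq_zero_or_pos n with rfl | hn
  · simp
  have h := sum_mul_bias f (fun _ => 1) (by simp) (by simp)
  have hn' : (n : ℝ) ≠ 0 := by positivity
  simpa [hn'] using h

/-- A ball changes the normalized load of bin `i` by its weight times `1 - 1/n` or `-1/n`. This
factor has mean `p i - 1/n` and second moment at most `p i + 1/n ≤ 3/n`; then `1 + x ≤ exp x`. The
sign `σ` serves the two exponentials of `cosh`. -/
theorem AllocLaw.lintegral_exp_le {n : ℕ} (hn : 0 < n) {E : Type*} [MeasurableSpace E]
    {c : E → Fin n} {w : E → ℝ} {μ : Measure E} {p : Fin n → ℝ} {W : Measure ℝ} {S : ℝ}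
    (h : AllocLaw c w μ p W) (hW : FiniteMgf S W) (hp0 : ∀ i, 0 ≤ p i) (hp1 : ∑ i, p i = 1)
    {γ : ℝ} (hγ : 0 < γ) (hγS : γ < 1 / (2 * S)) {σ : ℝ} (hσ : |σ| = 1)
    (i : Fin n) (hpi : p i ≤ 2 / n) :
    ∫⁻ e, ENNReal.ofReal (Real.exp (γ * σ * ((if c e = i then w e else 0) - w e / n))) ∂μ ≤
      ENNReal.ofReal (Real.exp (γ * σ * (p i - 1 / n) + 3 * S * γ ^ 2 / n)) := by
  have hn1 : (1 : ℝ) ≤ n := by exact_mod_cast hn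
  have hninv : 1 / (n : ℝ) ≤ 1 := by rw [div_le_one (by linarith)]; exact hn1
  have hninv0 : 0 < 1 / (n : ℝ) := by positivity
  have hS : 1 ≤ S := by
    obtain ⟨ζ, -, -, hS, -⟩ := hW.mgf
    exact (le_max_left _ _).trans hS
  let κ : Fin n → ℝ := fun k => σ * ((if k = i then 1 else 0) - 1 / n)
  have hκ : ∀ k, |κ k| ≤ 1 := by
    intro k
    simp only [κ, abs_mul, hσ, one_mul]
    split_ifs <;> rw [abs_le] <;> constructor <;> linarith
  have h1 := h (fun k v => ENNReal.ofReal (Real.exp (γ * κ k * v))) (fun k => by fun_prop)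
  have hrw : ∀ e, γ * σ * ((if c e = i then w e else 0) - w e / n) = γ * κ (c e) * w e := by
    intro e
    simp only [κ]
    split_ifs <;> ring
  simp only [hrw]
  rw [h1]
  have hterm : ∀ k, ENNReal.ofReal (p k) * ∫⁻ v, ENNReal.ofReal (Real.exp (γ * κ k * v)) ∂W ≤
      ENNReal.ofReal (p k * (1 + γ * κ k + S * γ ^ 2 * κ k ^ 2)) := by
    intro k
    rw [ENNReal.ofReal_mul (hp0 k)]
    gcongr
    exact hW.lintegral_exp_le hγ hγS (hκ k)
  refine (Finset.sum_le_sum fun k _ => hterm k).trans ?_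
  rw [← ENNReal.ofReal_sum_of_nonneg]
  · refine ENNReal.ofReal_le_ofReal ?_
    have hσ2 : σ ^ 2 = 1 := by rw [← sq_abs, hσ, one_pow]
    have e1 : ∑ k, p k * κ k = σ * (p i - 1 / n) := by
      have : ∀ k, p k * κ k = σ * ((if k = i then p k else 0) - p k * (1 / n)) := by
        intro k
        simp only [κ]
        split_ifs <;> ring
      simp only [this]
      rw [← Finset.mul_sum, Finset.sum_sub_distrib, ← Finset.sum_mul, hp1]
      simp
    have e2 : ∑ k, p k * κ k ^ 2 ≤ 3 / n := by
      have : ∀ k, p k * κ k ^ 2 ≤ (if k = i then p k else 0) + p k * (1 / n) := by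
        intro k
        have : κ k ^ 2 ≤ (if k = i then 1 else 0) + 1 / (n : ℝ) := by
          simp only [κ, mul_pow, hσ2, one_mul]
          split_ifs <;> nlinarith
        refine (mul_le_mul_of_nonneg_left this (hp0 k)).trans_eq ?_
        split_ifs <;> ring
      refine (Finset.sum_le_sum fun k _ => this k).trans ?_
      rw [Finset.sum_add_distrib, ← Finset.sum_mul, hp1]
      simp only [Finset.sum_ite_eq', Finset.mem_univ, if_true]
      have : 3 / (n : ℝ) = 2 / n + 1 * (1 / n) := by ring
      linarith
    have e3 : ∑ k, p k * (1 + γ * κ k + S * γ ^ 2 * κ k ^ 2) =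
        1 + γ * (∑ k, p k * κ k) + S * γ ^ 2 * ∑ k, p k * κ k ^ 2 := by
      have : ∀ k, p k * (1 + γ * κ k + S * γ ^ 2 * κ k ^ 2) =
          p k + γ * (p k * κ k) + S * γ ^ 2 * (p k * κ k ^ 2) := fun k => by ring
      simp only [this, Finset.sum_add_distrib, ← Finset.mul_sum, hp1]
    rw [e3, e1]
    have e4 : S * γ ^ 2 * ∑ k, p k * κ k ^ 2 ≤ S * γ ^ 2 * (3 / n) :=
      mul_le_mul_of_nonneg_left e2 (by positivity)
    have e5 := Real.add_one_le_exp (γ * σ * (p i - 1 / n) + 3 * S * γ ^ 2 / n)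
    have e6 : S * γ ^ 2 * (3 / (n : ℝ)) = 3 * S * γ ^ 2 / n := by ring
    linarith
  · intro k _
    refine mul_nonneg (hp0 k) ?_
    have : |γ * κ k| ≤ 1 := by
      rw [abs_mul, abs_of_pos hγ]
      have : γ ≤ 1 := by
        refine hγS.le.trans ?_
        rw [div_le_one (by linarith)]
        linarith
      nlinarith [hκ k, abs_nonneg (κ k)]
    have h2 := (abs_le.1 this).1
    have h3 : 0 ≤ S * γ ^ 2 * κ k ^ 2 := by positivity
    linarith

theorem lintegral_exp_sum_le {Ω E : Type*} [MeasurableSpace Ω] [MeasurableSpace E]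
    {P : Measure Ω} {μ : Measure E} {a : ℕ → Ω → E} (ha : ∀ s, Measurable (a s))
    (hindep : iIndepFun a P) (hlaw : ∀ s, P.map (a s) = μ) {g : E → ℝ} (hg : Measurable g)
    {q : ℝ} (hq : ∫⁻ e, ENNReal.ofReal (Real.exp (g e)) ∂μ ≤ ENNReal.ofReal (Real.exp q))
    (b t : ℕ) :
    ∫⁻ ω, ENNReal.ofReal (Real.exp (∑ j : Fin b, g (a (t + j) ω))) ∂P ≤
      ENNReal.ofReal (Real.exp (b * q)) := by
  have hm : Measurable fun e => ENNReal.ofReal (Real.exp (g e)) := by fun_prop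
  have hind : iIndepFun (fun (j : Fin b) ω => ENNReal.ofReal (Real.exp (g (a (t + j) ω)))) P := by
    refine (hindep.precomp (g := fun j : Fin b => t + (j : ℕ)) ?_).comp _ (fun _ => hm)
    intro _ _ hij
    simpa [Fin.ext_iff] using hij
  have h1 := lintegral_prod_eq_prod_lintegral_of_indepFun Finset.univ _ hind
    (fun j => hm.comp (ha _))
  have h2 : ∀ ω, ENNReal.ofReal (Real.exp (∑ j : Fin b, g (a (t + j) ω))) =
      ∏ j : Fin b, ENNReal.ofReal (Real.exp (g (a (t + j) ω))) := by
    intro ω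
    rw [Real.exp_sum, ENNReal.ofReal_prod_of_nonneg fun _ _ => (Real.exp_pos _).le]
  simp only [h2]
  rw [h1]
  have h3 : ∀ j : Fin b, ∫⁻ ω, ENNReal.ofReal (Real.exp (g (a (t + j) ω))) ∂P ≤
      ENNReal.ofReal (Real.exp q) := by
    intro j
    rw [← lintegral_map hm (ha _), hlaw]
    exact hq
  refine (Finset.prod_le_prod' fun j _ => h3 j).trans_eq ?_
  rw [Finset.prod_const, Finset.card_univ, Fintype.card_fin,
    ← ENNReal.ofReal_pow (Real.exp_pos _).le, ← Real.exp_nat_mul]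

/-- The hyperbolic cosine potential with smoothing parameter `γ`. -/
def potential {n : ℕ} (γ : ℝ) (x : Fin n → ℝ) : ℝ :=
  ∑ i, 2 * Real.cosh (γ * (x i - (∑ j, x j) / n))

theorem potential_nonneg {n : ℕ} (γ : ℝ) (x : Fin n → ℝ) : 0 ≤ potential γ x :=
  Finset.sum_nonneg fun _ _ => mul_nonneg zero_le_two (Real.cosh_pos _).le

theorem measurable_potential {n : ℕ} (γ : ℝ) :
    Measurable (potential γ : (Fin n → ℝ) → ℝ) := by
  have : Continuous (potential γ : (Fin n → ℝ) → ℝ) := by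
    unfold potential
    fun_prop
  exact this.measurable

/-- The bias yields a decrease of `θ / 6` times the potential, while the second-order terms cost `3
* θ ^ 2` times it. At `θ = 1/36` this cost is `θ / 12`, exactly half of the gain. -/
theorem sum_exp_drift_le {n : ℕ} (hn : 0 < n) (f z : Fin n → ℝ) (hz : ∑ i, z i = 0)
    (h : ∀ i j, f i < f j → z i ≤ z j) (h' : ∀ i j, f i = f j → z i = z j)
    {θ η : ℝ} (hθ : θ = 1 / 36) (hη0 : 0 ≤ η) (hη : η ≤ θ ^ 2) :
    ∑ i, (Real.exp (z i) * Real.exp (θ * bias f i + η) +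
      Real.exp (-z i) * Real.exp (-(θ * bias f i) + η)) ≤
      (1 - θ / 12) * ∑ i, 2 * Real.cosh (z i) + 5 / 6 * θ * n := by
  have hexp : ∀ t, |t| ≤ 1 → Real.exp (θ * t + η) ≤ 1 + θ * t + 3 * θ ^ 2 := by
    intro t ht
    obtain ⟨h1, h2⟩ := abs_le.1 ht
    subst hθ
    have hle : |1 / 36 * t + η| ≤ 1 / 36 + (1 / 36) ^ 2 := by
      rw [abs_le]
      constructor <;> nlinarith
    have h3 := (abs_le.1 (Real.abs_exp_sub_one_sub_id_le (x := 1 / 36 * t + η)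
      (hle.trans (by norm_num)))).2
    have h4 : (1 / 36 * t + η) ^ 2 ≤ (1 / 36 + (1 / 36) ^ 2) ^ 2 := sq_le_sq' (by
      linarith [(abs_le.1 hle).1]) (abs_le.1 hle).2
    norm_num at h4 hη ⊢
    linarith
  have hterm : ∀ i, Real.exp (z i) * Real.exp (θ * bias f i + η) +
      Real.exp (-z i) * Real.exp (-(θ * bias f i) + η) ≤
      (1 + 3 * θ ^ 2) * (2 * Real.cosh (z i)) + θ * (2 * Real.sinh (z i) * bias f i) := by
    intro i
    have h1 := hexp (bias f i) (abs_bias_le_one f i)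
    have h2 := hexp (-bias f i) (by rw [abs_neg]; exact abs_bias_le_one f i)
    rw [mul_neg] at h2
    rw [Real.cosh_eq, Real.sinh_eq]
    have h3 := mul_le_mul_of_nonneg_left h1 (Real.exp_pos (z i)).le
    have h4 := mul_le_mul_of_nonneg_left h2 (Real.exp_pos (-z i)).le
    linarith
  refine (Finset.sum_le_sum fun i _ => hterm i).trans ?_
  rw [Finset.sum_add_distrib, ← Finset.mul_sum _ _ (1 + 3 * θ ^ 2), ← Finset.mul_sum _ _ θ]
  have := sum_sinh_mul_bias_le hn f z hz h h'
  subst hθ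
  linarith

theorem sum_sub_average {n : ℕ} (hn : 0 < n) (x : Fin n → ℝ) :
    ∑ i, (x i - (∑ j, x j) / n) = 0 := by
  have hn' : (n : ℝ) ≠ 0 := by positivity
  rw [Finset.sum_sub_distrib, Finset.sum_const, Finset.card_univ, Fintype.card_fin, nsmul_eq_mul,
    mul_div_cancel₀ _ hn', sub_self]

/-- The order of the bins by `f` is compatible with the order by load. -/
def Compatible {n : ℕ} (f x : Fin n → ℝ) : Prop :=
  (∀ i j, f i < f j → x i ≤ x j) ∧ ∀ i j, f i = f j → x i = x j

/-- The one-batch drift from a deterministic start `x`. Keeping `f` separate from `x` lets one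
statement cover both tie-breaking rules. -/
theorem lintegral_potential_le {n : ℕ} (hn : 0 < n) {Ω E : Type*} [MeasurableSpace Ω]
    [MeasurableSpace E] {P : Measure Ω} {μ : Measure E} {a : ℕ → Ω → E}
    (ha : ∀ s, Measurable (a s)) (hindep : iIndepFun a P) (hlaw : ∀ s, P.map (a s) = μ)
    {W : Measure ℝ} {S β γ : ℝ} (hW : FiniteMgf S W) (hβ0 : 0 ≤ β) (hβ1 : β ≤ 1)
    (hγ : 0 < γ) (hγS : γ < 1 / (2 * S)) {b : ℕ} (hθ : b * γ * β / n = 1 / 36)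
    (hη : b * (3 * S * γ ^ 2 / n) ≤ (1 / 36) ^ 2)
    {c : E → Fin n} (hc : Measurable c) {w : E → ℝ} (hw : Measurable w) {f x : Fin n → ℝ}
    (hf : Compatible f x) (hlawc : AllocLaw c w μ (fun i => (1 + β * bias f i) / n) W) (t : ℕ) :
    ∫⁻ ω, ENNReal.ofReal (potential γ fun i =>
        x i + ∑ j : Fin b, if c (a (t + j) ω) = i then w (a (t + j) ω) else 0) ∂P ≤
      ENNReal.ofReal (1 - 1 / 36 / 12) * ENNReal.ofReal (potential γ x) +
        ENNReal.ofReal (5 / 6 * (1 / 36) * n) := by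
  have hn' : (0 : ℝ) < n := by positivity
  have hS : 1 ≤ S := by
    obtain ⟨ζ, -, -, hS, -⟩ := hW.mgf
    exact (le_max_left _ _).trans hS
  set z : Fin n → ℝ := fun i => γ * (x i - (∑ j, x j) / n) with hz
  set η := b * (3 * S * γ ^ 2 / n) with hηdef
  have hη0 : 0 ≤ η := by positivity
  have hz0 : ∑ i, z i = 0 := by
    rw [hz, ← Finset.mul_sum, sum_sub_average hn, mul_zero]
  let inc : Fin n → E → ℝ := fun i e => (if c e = i then w e else 0) - w e / n
  have hinc : ∀ i, Measurable (inc i) := fun i =>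
    (Measurable.ite (hc (measurableSet_singleton i)) hw measurable_const).sub (hw.div_const _)
  have hpot : ∀ ω, potential γ (fun i =>
      x i + ∑ j : Fin b, if c (a (t + j) ω) = i then w (a (t + j) ω) else 0) =
      ∑ i, (Real.exp (z i) * Real.exp (∑ j : Fin b, γ * 1 * inc i (a (t + j) ω)) +
        Real.exp (-z i) * Real.exp (∑ j : Fin b, γ * (-1) * inc i (a (t + j) ω))) := by
    intro ω
    have havg : ∑ i, (x i + ∑ j : Fin b, if c (a (t + j) ω) = i then w (a (t + j) ω) else 0) =
        ∑ i, x i + ∑ j : Fin b, w (a (t + j) ω) := by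
      rw [Finset.sum_add_distrib, Finset.sum_comm]
      simp
    unfold potential
    refine Finset.sum_congr rfl fun i _ => ?_
    rw [havg, Real.cosh_eq, ← Real.exp_add, ← Real.exp_add, ← Finset.mul_sum, ← Finset.mul_sum]
    simp only [inc, Finset.sum_sub_distrib, ← Finset.sum_div, hz]
    rw [mul_div_cancel₀ _ (two_ne_zero)]
    congr 2 <;> ring
  have hp0 : ∀ i, 0 ≤ (1 + β * bias f i) / (n : ℝ) := fun i => by
    have := (abs_le.1 (abs_bias_le_one f i)).1
    exact div_nonneg (by nlinarith) hn'.le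
  have hp2 : ∀ i, (1 + β * bias f i) / (n : ℝ) ≤ 2 / n := fun i => by
    have := (abs_le.1 (abs_bias_le_one f i)).2
    exact div_le_div_of_nonneg_right (by nlinarith) hn'.le
  have hp1 : ∑ i, (1 + β * bias f i) / (n : ℝ) = 1 := by
    rw [← Finset.sum_div, Finset.sum_add_distrib, ← Finset.mul_sum, sum_bias]
    simp [hn'.ne']
  have hmgf : ∀ σ : ℝ, |σ| = 1 → ∀ i,
      ∫⁻ ω, ENNReal.ofReal (Real.exp (∑ j : Fin b, γ * σ * inc i (a (t + j) ω))) ∂P ≤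
        ENNReal.ofReal (Real.exp (σ * (1 / 36 * bias f i) + η)) := by
    intro σ hσ i
    refine (lintegral_exp_sum_le ha hindep hlaw (g := fun e => γ * σ * inc i e)
      ((hinc i).const_mul _)
      (hlawc.lintegral_exp_le hn hW hp0 hp1 hγ hγS hσ i (hp2 i)) b t).trans_eq ?_
    congr 2
    rw [hηdef, ← hθ]
    field_simp
    ring
  simp only [hpot]
  have hmeas : ∀ (σ : ℝ) i, Measurable fun ω =>
      ENNReal.ofReal (Real.exp (∑ j : Fin b, γ * σ * inc i (a (t + j) ω))) := by
    intro σ i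
    refine ENNReal.measurable_ofReal.comp (Real.measurable_exp.comp ?_)
    exact Finset.measurable_sum _ fun j _ => ((hinc i).comp (ha _)).const_mul _
  have hsplit : ∀ ω, ENNReal.ofReal
      (∑ i, (Real.exp (z i) * Real.exp (∑ j : Fin b, γ * 1 * inc i (a (t + j) ω)) +
        Real.exp (-z i) * Real.exp (∑ j : Fin b, γ * (-1) * inc i (a (t + j) ω)))) =
      ∑ i, (ENNReal.ofReal (Real.exp (z i)) *
          ENNReal.ofReal (Real.exp (∑ j : Fin b, γ * 1 * inc i (a (t + j) ω))) +
        ENNReal.ofReal (Real.exp (-z i)) *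
          ENNReal.ofReal (Real.exp (∑ j : Fin b, γ * (-1) * inc i (a (t + j) ω)))) := by
    intro ω
    rw [ENNReal.ofReal_sum_of_nonneg fun _ _ => by positivity]
    refine Finset.sum_congr rfl fun i _ => ?_
    rw [ENNReal.ofReal_add (by positivity) (by positivity),
      ENNReal.ofReal_mul (Real.exp_pos _).le, ENNReal.ofReal_mul (Real.exp_pos _).le]
  simp only [hsplit]
  have hmeas' : ∀ i, Measurable fun ω => ENNReal.ofReal (Real.exp (z i)) *
          ENNReal.ofReal (Real.exp (∑ j : Fin b, γ * 1 * inc i (a (t + j) ω))) +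
        ENNReal.ofReal (Real.exp (-z i)) *
          ENNReal.ofReal (Real.exp (∑ j : Fin b, γ * (-1) * inc i (a (t + j) ω))) := fun i =>
    ((hmeas 1 i).const_mul _).add ((hmeas (-1) i).const_mul _)
  rw [lintegral_finsetSum _ fun i _ => hmeas' i]
  have hi : ∀ i, ∫⁻ ω, (ENNReal.ofReal (Real.exp (z i)) *
          ENNReal.ofReal (Real.exp (∑ j : Fin b, γ * 1 * inc i (a (t + j) ω))) +
        ENNReal.ofReal (Real.exp (-z i)) *
          ENNReal.ofReal (Real.exp (∑ j : Fin b, γ * (-1) * inc i (a (t + j) ω)))) ∂P ≤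
      ENNReal.ofReal (Real.exp (z i) * Real.exp (1 / 36 * bias f i + η) +
        Real.exp (-z i) * Real.exp (-(1 / 36 * bias f i) + η)) := by
    intro i
    rw [lintegral_add_left ((hmeas 1 i).const_mul _), lintegral_const_mul _ (hmeas 1 i),
      lintegral_const_mul _ (hmeas (-1) i), ENNReal.ofReal_add (by positivity) (by positivity),
      ENNReal.ofReal_mul (Real.exp_pos _).le, ENNReal.ofReal_mul (Real.exp_pos _).le]
    have h1 := hmgf 1 (by simp) i
    have h2 := hmgf (-1) (by simp) i
    rw [one_mul] at h1
    rw [neg_one_mul] at h2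
    gcongr
  refine (Finset.sum_le_sum fun i _ => hi i).trans ?_
  rw [← ENNReal.ofReal_sum_of_nonneg fun _ _ => by positivity,
    ← ENNReal.ofReal_mul (by norm_num), ← ENNReal.ofReal_add
      (mul_nonneg (by norm_num) (potential_nonneg _ _)) (by positivity)]
  refine ENNReal.ofReal_le_ofReal ?_
  exact sum_exp_drift_le hn f z hz0
    (fun i j hij => mul_le_mul_of_nonneg_left (by linarith [hf.1 i j hij]) hγ.le)
    (fun i j hij => by simp only [hz, hf.2 i j hij]) rfl hη0 hη


/-! ### Markov chains driven by batches of independent variables -/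

section Chain

variable {Ω E X : Type*} [mE : MeasurableSpace E] [MeasurableSpace X]
  {a : ℕ → Ω → E} {b : ℕ} {u : X → (Fin b → E) → X} {Y : ℕ → Ω → X} {x₀ : X}

theorem measurable_chain (hu : Measurable (Function.uncurry u)) (h0 : ∀ ω, Y 0 ω = x₀)
    (hs : ∀ r ω, Y (r + 1) ω = u (Y r ω) fun j => a (r * b + j) ω) (r : ℕ) :
    Measurable[⨆ s ∈ Set.Iio (r * b), mE.comap (a s)] (Y r) := by
  induction r with
  | zero =>
    rw [show Y 0 = fun _ => x₀ from funext h0]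
    exact @measurable_const _ _ _ (_) _
  | succ r ih =>
    -- Stated for an arbitrary σ-algebra on `Ω`, to be applied to the one generated by the balls
    -- before time `(r + 1) * b`.
    have step : ∀ m : MeasurableSpace Ω, Measurable[m] (Y r) →
        (∀ j : Fin b, Measurable[m] (a (r * b + j))) → Measurable[m] (Y (r + 1)) := by
      intro m h1 h2
      rw [show Y (r + 1) = Function.uncurry u ∘ fun ω => (Y r ω, fun j : Fin b => a (r * b + j) ω)
        from funext (hs r)]
      exact hu.comp (h1.prodMk (measurable_pi_lambda _ h2))
    refine step _ (ih.mono ?_ le_rfl) fun j => ?_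
    · exact biSup_mono fun s (h : s < r * b) => h.trans_le (Nat.mul_le_mul_right b r.le_succ)
    · have hj : r * b + j ∈ Set.Iio ((r + 1) * b) := by
        have := j.2
        rw [Set.mem_Iio, add_mul]
        omega
      exact (comap_measurable (a (r * b + j))).mono
        (le_biSup (fun s => mE.comap (a s)) hj) le_rfl

variable [MeasurableSpace Ω] {P : Measure Ω}

/-- The state `Y r` is a function of the balls with index below `r * b`, a set of indices disjoint
from that of the next batch. -/
theorem indepFun_chain (ha : ∀ s, Measurable (a s)) (hindep : iIndepFun a P)
    (hu : Measurable (Function.uncurry u)) (h0 : ∀ ω, Y 0 ω = x₀)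
    (hs : ∀ r ω, Y (r + 1) ω = u (Y r ω) fun j => a (r * b + j) ω) (r : ℕ) :
    IndepFun (Y r) (fun ω (j : Fin b) => a (r * b + j) ω) P := by
  have h := indep_iSup_of_disjoint (fun s => (ha s).comap_le) hindep.iIndep
    (S := Set.Iio (r * b)) (T := Set.Ici (r * b))
    (Set.disjoint_left.2 fun s (h1 : s < r * b) (h2 : r * b ≤ s) => not_lt_of_ge h2 h1)
  rw [IndepFun_iff_Indep]
  refine indep_of_indep_of_le_left (indep_of_indep_of_le_right h ?_) ?_
  · have hpi : ∀ m : MeasurableSpace Ω, (∀ j : Fin b, Measurable[m] (a (r * b + j))) →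
        Measurable[m] fun ω (j : Fin b) => a (r * b + j) ω :=
      fun m h => measurable_pi_lambda _ h
    refine (hpi _ fun j => ?_).comap_le
    have hj : r * b + j ∈ Set.Ici (r * b) := by simp
    exact (comap_measurable (a (r * b + j))).mono
      (le_biSup (fun s => mE.comap (a s)) hj) le_rfl
  · exact (measurable_chain hu h0 hs r).comap_le

/-- A drift inequality for a potential `V` bounds its expectation at all times. -/
theorem lintegral_chain_le [IsProbabilityMeasure P] (ha : ∀ s, Measurable (a s))
    (hindep : iIndepFun a P) (hu : Measurable (Function.uncurry u)) (h0 : ∀ ω, Y 0 ω = x₀)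
    (hs : ∀ r ω, Y (r + 1) ω = u (Y r ω) fun j => a (r * b + j) ω) {I : Set X}
    (hI : ∀ r ω, Y r ω ∈ I) {V : X → ENNReal} (hV : Measurable V) {A B K : ENNReal}
    (hdrift : ∀ x ∈ I, ∀ t, ∫⁻ ω, V (u x fun j => a (t + j) ω) ∂P ≤ A * V x + B)
    (hV0 : V x₀ ≤ K) (hK : A * K + B ≤ K) (r : ℕ) :
    ∫⁻ ω, V (Y r ω) ∂P ≤ K := by
  have hYm : ∀ r, Measurable (Y r) := fun r => (measurable_chain hu h0 hs r).mono
    (iSup₂_le fun s _ => (ha s).comap_le) le_rfl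
  induction r with
  | zero => simpa [h0] using hV0
  | succ r ih =>
    have hbm : Measurable fun ω (j : Fin b) => a (r * b + j) ω :=
      measurable_pi_lambda _ fun j => ha _
    have hmap := (indepFun_iff_map_prod_eq_prod_map_map (hYm r).aemeasurable
      hbm.aemeasurable).1 (indepFun_chain ha hindep hu h0 hs r)
    have hVu : Measurable fun p : X × (Fin b → E) => V (u p.1 p.2) := hV.comp hu
    have := Measure.isProbabilityMeasure_map (μ := P) hbm.aemeasurable
    calc ∫⁻ ω, V (Y (r + 1) ω) ∂P
        = ∫⁻ p, V (u p.1 p.2) ∂(P.map fun ω => (Y r ω, fun j : Fin b => a (r * b + j) ω)) := by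
          rw [lintegral_map hVu ((hYm r).prodMk hbm)]
          simp only [hs]
      -- Independence and Tonelli freeze the state while the batch is averaged, which is the
      -- situation of `hdrift`.
      _ = ∫⁻ ω, ∫⁻ ω', V (u (Y r ω) fun j => a (r * b + j) ω') ∂P ∂P := by
          rw [hmap, lintegral_prod _ hVu.aemeasurable,
            lintegral_map hVu.lintegral_prod_right' (hYm r)]
          refine lintegral_congr fun ω => ?_
          exact lintegral_map (hVu.comp measurable_prodMk_left) hbm
      _ ≤ ∫⁻ ω, (A * V (Y r ω) + B) ∂P :=
          lintegral_mono fun ω => hdrift _ (hI r ω) _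
      _ = A * ∫⁻ ω, V (Y r ω) ∂P + B := by
          have hVY : Measurable fun ω => V (Y r ω) := hV.comp (hYm r)
          rw [lintegral_add_right _ measurable_const, lintegral_const_mul _ hVY]
          simp
      _ ≤ A * K + B := by gcongr
      _ ≤ K := hK

end Chain

/-! ### The bound on the gap -/

theorem exp_le_potential_of_lt_gap {n : ℕ} (hn : 0 < n) {γ : ℝ} (hγ : 0 < γ) {x : Fin n → ℝ}
    {g : ℝ} (h : g < gap x) : Real.exp (γ * g) ≤ potential γ x := by
  have : Nonempty (Fin n) := ⟨⟨0, hn⟩⟩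
  obtain ⟨i, hi⟩ := exists_eq_ciSup_of_finite (f := x)
  rw [gap, ← hi] at h
  refine le_trans ?_ (Finset.single_le_sum
    (f := fun i => 2 * Real.cosh (γ * (x i - (∑ j, x j) / n)))
    (fun i _ => mul_nonneg zero_le_two (Real.cosh_pos _).le) (Finset.mem_univ i))
  rw [Real.cosh_eq]
  have h1 := Real.exp_le_exp.2 (mul_le_mul_of_nonneg_left h.le hγ.le)
  have h2 := Real.exp_pos (-(γ * (x i - (∑ j, x j) / n)))
  linarith

/-- Markov's inequality for the potential. Passing to the complement by subadditivity makes
measurability of the gap event unnecessary. -/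
theorem one_sub_le_measureReal_of_lintegral_le {Ω : Type*} [MeasurableSpace Ω] {P : Measure Ω}
    [IsProbabilityMeasure P] {n : ℕ} (hn : 0 < n) {γ g : ℝ} (hγ : 0 < γ)
    {Y : Ω → Fin n → ℝ} {K δ : ℝ} (hδ : 0 ≤ δ)
    (hY : Measurable Y) (hK : ∫⁻ ω, ENNReal.ofReal (potential γ (Y ω)) ∂P ≤ ENNReal.ofReal K)
    (hg : K ≤ δ * Real.exp (γ * g)) :
    1 - δ ≤ P.real {ω | gap (Y ω) ≤ g} := by
  set A := {ω | gap (Y ω) ≤ g}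
  have hpos := Real.exp_pos (γ * g)
  have hm : Measurable fun ω => ENNReal.ofReal (potential γ (Y ω)) :=
    ENNReal.measurable_ofReal.comp ((measurable_potential γ).comp hY)
  have h1 : P Aᶜ ≤ ENNReal.ofReal δ := by
    have h2 := mul_meas_ge_le_lintegral (μ := P) hm (ENNReal.ofReal (Real.exp (γ * g)))
    have h3 : P Aᶜ ≤ P {ω | ENNReal.ofReal (Real.exp (γ * g)) ≤
        ENNReal.ofReal (potential γ (Y ω))} := by
      refine measure_mono fun ω hω => ENNReal.ofReal_le_ofReal ?_
      exact exp_le_potential_of_lt_gap hn hγ (not_le.1 hω)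
    have h4 : ENNReal.ofReal (Real.exp (γ * g)) * P Aᶜ ≤
        ENNReal.ofReal (Real.exp (γ * g)) * ENNReal.ofReal δ := by
      refine (mul_le_mul_right h3 _).trans (h2.trans (hK.trans ?_))
      rw [← ENNReal.ofReal_mul hpos.le, mul_comm]
      exact ENNReal.ofReal_le_ofReal hg
    exact (ENNReal.mul_le_mul_iff_right (by simpa using hpos) ENNReal.ofReal_ne_top).1 h4
  have h5 : P.real Aᶜ ≤ δ := ENNReal.toReal_le_of_le_ofReal hδ h1
  have h6 : P.real Set.univ ≤ P.real A + P.real Aᶜ := by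
    rw [← Set.union_compl_self A]
    exact measureReal_union_le _ _
  rw [probReal_univ] at h6
  linarith

theorem potential_zero {n : ℕ} (γ : ℝ) : potential γ (fun _ : Fin n => 0) = 2 * n := by
  simp [potential, mul_comm]

/-- The bound on the gap of an allocation process in the batched setting: `c x e` is the bin of the
ball with randomness `e` in a batch that starts with the load vector `x`, and the load vector may be
relabelled in any way that keeps the potential. -/
theorem one_sub_le_gap_le {n b : ℕ} {S β : ℝ} {W : Measure ℝ} (hn : 2 ≤ n) (hS : 1 ≤ S)
    (hSb : S ≤ b / (4 * n)) (hW : FiniteMgf S W) (hβ : β = √(4 * S * (n / b)))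
    {E : Type*} [MeasurableSpace E] {μ : Measure E} {w : E → ℝ} (hw : Measurable w)
    {c : (Fin n → ℝ) → E → Fin n} (hc : ∀ x, Measurable (c x))
    {u : (Fin n → ℝ) → (Fin b → E) → Fin n → ℝ} (hu : Measurable (Function.uncurry u))
    (hpot : ∀ γ x e, potential γ (u x e) =
      potential γ fun i => x i + ∑ j, if c x (e j) = i then w (e j) else 0)
    {I : Set (Fin n → ℝ)} (hI0 : (fun _ => 0) ∈ I) (hI : ∀ x ∈ I, ∀ e, u x e ∈ I)
    (hlawc : ∀ x ∈ I, ∃ f, Compatible f x ∧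
      AllocLaw (c x) w μ (fun i => (1 + β * bias f i) / n) W)
    {L : (ℕ → E) → ℕ → Fin n → ℝ} (hL0 : ∀ a, L a 0 = fun _ => 0)
    (hLs : ∀ a r, L a (r + 1) = u (L a r) fun j => a (r * b + j))
    {Ω : Type*} [MeasurableSpace Ω] {P : Measure Ω} [IsProbabilityMeasure P] {a : ℕ → Ω → E}
    (hindep : iIndepFun a P) (hlaw : ∀ s, HasLaw (a s) μ P) (r : ℕ) :
    1 - 1 / (n : ℝ) ^ 2 ≤
      P.real {ω | gap (L (fun s => a s ω) r) ≤ 504 * √(S * b / n) * Real.log n} := by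
  -- `HasLaw` gives only a.e. measurability; measurable versions of the countably many balls agree
  -- with them simultaneously almost surely.
  wlog ha : ∀ s, Measurable (a s) generalizing a
  · have hae := fun s => (hlaw s).aemeasurable.ae_eq_mk
    have h := this (hindep.congr hae) (fun s => (hlaw s).congr (hae s).symm)
      fun s => (hlaw s).aemeasurable.measurable_mk
    refine h.trans_eq (measureReal_congr ?_)
    have hall : ∀ᵐ ω ∂P, ∀ s, a s ω = (hlaw s).aemeasurable.mk (a s) ω := ae_all_iff.2 hae
    filter_upwards [hall] with ω hω
    rw [eq_iff_iff]
    change gap (L (fun s => (hlaw s).aemeasurable.mk (a s) ω) r) ≤ _ ↔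
      gap (L (fun s => a s ω) r) ≤ _
    simp only [hω]
  have hn0 : 0 < n := by omega
  have hn2 : (2 : ℝ) ≤ n := by exact_mod_cast hn
  have hnpos : (0 : ℝ) < n := by linarith
  have hSb' : S * (4 * n) ≤ b := by rwa [le_div_iff₀ (by positivity)] at hSb
  have hb : (0 : ℝ) < b := by nlinarith
  have hβ2 : β ^ 2 = 4 * S * (n / b) := by
    rw [hβ, Real.sq_sqrt (by positivity)]
  have hβ0 : 0 < β := by
    rw [hβ]
    positivity
  have hβ1 : β ≤ 1 := by
    have : β ^ 2 ≤ 1 := by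
      rw [hβ2, ← mul_div_assoc, div_le_one hb]
      linarith
    nlinarith
  have hβb : b * β ^ 2 = 4 * S * n := by
    rw [hβ2]
    field_simp
  have hSpos : 0 < S := by linarith
  -- Since `b * β ^ 2 = 4 * S * n`, this choice gives `b * γ * β / n = 4 / 144 = 1 / 36`.
  set γ := β / (144 * S) with hγdef
  have hγ : 0 < γ := by positivity
  have hγS : γ < 1 / (2 * S) := by
    rw [hγdef, div_lt_div_iff₀ (by positivity) (by positivity)]
    nlinarith
  have hθ : b * γ * β / n = 1 / 36 := by
    have : b * γ * β / n = (b * β ^ 2) / (144 * S * n) := by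
      rw [hγdef]
      field_simp
    rw [this, hβb]
    field_simp
    norm_num
  have hη : b * (3 * S * γ ^ 2 / n) ≤ (1 / 36) ^ 2 := by
    have : b * (3 * S * γ ^ 2 / n) = 3 * (b * β ^ 2) / (144 ^ 2 * S * n) := by
      rw [hγdef]
      field_simp
    rw [this, hβb, div_le_iff₀ (by positivity)]
    nlinarith [mul_pos hSpos hnpos]
  have hsqrt : √(S * b / n) = 2 * S / β := by
    have : S * b / n = (2 * S / β) ^ 2 := by
      rw [div_pow, hβ2]
      field_simp
      norm_num
    rw [this, Real.sqrt_sq (by positivity)]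
  have hYI : ∀ r ω, L (fun s => a s ω) r ∈ I := by
    intro r ω
    induction r with
    | zero => rw [hL0]; exact hI0
    | succ r ih => rw [hLs]; exact hI _ ih _
  have hlaw' : ∀ s, P.map (a s) = μ := fun s => (hlaw s).map_eq
  have hV : Measurable fun x : Fin n → ℝ => ENNReal.ofReal (potential γ x) :=
    ENNReal.measurable_ofReal.comp (measurable_potential γ)
  -- `10 n` is the fixed point of the drift recursion, `θ / 12 * (10 n) = 5 / 6 * θ * n`, and it
  -- exceeds the initial potential `2 n`.
  have hE := lintegral_chain_le ha hindep hu (Y := fun r ω => L (fun s => a s ω) r)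
    (fun ω => hL0 _) (fun r ω => hLs _ r) hYI hV (K := ENNReal.ofReal (10 * n))
    (fun x hx t => by
      obtain ⟨f, hf, hal⟩ := hlawc x hx
      simp only [hpot]
      exact lintegral_potential_le hn0 ha hindep hlaw' hW hβ0.le hβ1 hγ hγS hθ hη (hc x) hw hf
        hal t)
    (by
      rw [potential_zero]
      exact ENNReal.ofReal_le_ofReal (by linarith))
    (by
      rw [← ENNReal.ofReal_mul (by norm_num), ← ENNReal.ofReal_add (by positivity) (by positivity)]
      exact ENNReal.ofReal_le_ofReal (by linarith)) r
  have hYm : Measurable fun ω => L (fun s => a s ω) r :=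
    (measurable_chain (Y := fun r ω => L (fun s => a s ω) r) hu (fun ω => hL0 _)
      (fun r ω => hLs _ r) r).mono (iSup₂_le fun s _ => (ha s).comap_le) le_rfl
  refine one_sub_le_measureReal_of_lintegral_le hn0 hγ (by positivity) hYm hE ?_
  -- `504 * 2 / 144 = 7`. Markov then leaves `10 n / n ^ 7`, which is at most `n ^ (-2)` because `10
  -- ≤ n ^ 4` for `n ≥ 2`.
  have hexp : γ * (504 * √(S * b / n) * Real.log n) = (7 : ℕ) * Real.log n := by
    rw [hsqrt, hγdef]
    field_simp
    push_cast
    ring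
  rw [hexp, Real.exp_nat_mul, Real.exp_log hnpos, one_div_mul_eq_div, le_div_iff₀ (by positivity)]
  have h4 : (10 : ℝ) ≤ n ^ 4 := by
    have := pow_le_pow_left₀ zero_le_two hn2 4
    linarith
  nlinarith [mul_le_mul_of_nonneg_right h4 (by positivity : (0 : ℝ) ≤ n ^ 3)]


/-! ### Discrete laws -/

section DiscreteLaw

variable {ι : Type*} [Fintype ι] [MeasurableSpace ι]

instance isFiniteMeasure_discreteLaw (q : ι → ℝ) : IsFiniteMeasure (discreteLaw q) := by
  constructor
  simp [discreteLaw, ENNReal.sum_lt_top]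

theorem lintegral_discreteLaw_prod [MeasurableSingletonClass ι] (q : ι → ℝ) {Y : Type*}
    [MeasurableSpace Y] (ν : Measure Y) [SFinite ν] {F : ι × Y → ENNReal} (hF : Measurable F) :
    ∫⁻ p, F p ∂((discreteLaw q).prod ν) = ∑ i, ENNReal.ofReal (q i) * ∫⁻ y, F (i, y) ∂ν := by
  rw [lintegral_prod _ hF.aemeasurable, discreteLaw, lintegral_finsetSum_measure]
  simp [lintegral_smul_measure, lintegral_dirac]

end DiscreteLaw

theorem measurable_eval_pair {n : ℕ} : Measurable fun p : (Fin n → ℝ) × Fin n => p.1 p.2 :=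
  measurable_from_prod_countable_left fun i => measurable_pi_apply i

/-! ### The process with random tie-breaking -/

theorem measurable_chosenBin {n : ℕ} :
    Measurable fun p : (Fin n → ℝ) × Ball n => chosenBin p.1 p.2 := by
  have h1 : Measurable fun p : (Fin n → ℝ) × Ball n => p.1 p.2.1 :=
    measurable_eval_pair.comp (measurable_fst.prodMk (by fun_prop))
  have h2 : Measurable fun p : (Fin n → ℝ) × Ball n => p.1 p.2.2.1 :=
    measurable_eval_pair.comp (measurable_fst.prodMk (by fun_prop))
  have h3 : Measurable fun p : (Fin n → ℝ) × Ball n => p.2.2.2.1 := by fun_prop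
  have h4 : Measurable fun p : (Fin n → ℝ) × Ball n => p.2.2.2.2.1 := by fun_prop
  refine Measurable.ite (h3 (measurableSet_singleton true)) ?_ (by fun_prop)
  refine Measurable.ite (measurableSet_lt h1 h2) (by fun_prop) ?_
  refine Measurable.ite (measurableSet_lt h2 h1) (by fun_prop) ?_
  exact Measurable.ite (h4 (measurableSet_singleton true)) (by fun_prop) (by fun_prop)

theorem measurable_weight {n : ℕ} : Measurable (Ball.weight : Ball n → ℝ) := by
  unfold Ball.weight
  fun_prop

/-- The fair tie coin is what makes the allocation probability depend on `x` only through `bias`.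
The weight `0` is a placeholder, as `chosenBin` ignores that component. -/
theorem sum_chosenBin {n : ℕ} (hn : 0 < n) (β : ℝ) (x : Fin n → ℝ) (k : Fin n) :
    ∑ i₁, ∑ i₂, ∑ d : Bool, ∑ t : Bool, (if chosenBin x (i₁, i₂, d, t, 0) = k then
      1 / (n : ℝ) * (1 / (n : ℝ) * ((if d then β else 1 - β) * (1 / 2))) else 0) =
      (1 + β * bias x k) / n := by
  have hn' : (n : ℝ) ≠ 0 := by positivity
  let δ : Fin n → ℝ := fun i => if i = k then 1 else 0
  let sg : Fin n → Fin n → ℝ := fun i j => (SignType.sign (x j - x i) : ℝ)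
  -- Averaged over both coins, the choice is linear in the sign of `x i₂ - x i₁`, and ties are the
  -- case of sign zero. Each of the two sign terms then contributes half of the bias.
  have hpt : ∀ i₁ i₂, ∑ d : Bool, ∑ t : Bool, (if chosenBin x (i₁, i₂, d, t, 0) = k then
      1 / (n : ℝ) * (1 / (n : ℝ) * ((if d then β else 1 - β) * (1 / 2))) else 0) =
      1 / (n : ℝ) ^ 2 * ((1 - β / 2) * δ i₁ + β / 2 * δ i₂ + β / 2 * (sg i₁ i₂ * δ i₁)
        - β / 2 * (sg i₁ i₂ * δ i₂)) := by
    intro i₁ i₂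
    simp only [Fintype.sum_bool, chosenBin, δ, sg]
    rcases lt_trichotomy (x i₁) (x i₂) with h | h | h
    · simp only [sign_pos (sub_pos.2 h), h, if_true]
      by_cases h1 : i₁ = k <;> by_cases h2 : i₂ = k <;> simp [h1, h2] <;> ring
    · simp only [h, lt_irrefl, if_false, sub_self, sign_zero]
      by_cases h1 : i₁ = k <;> by_cases h2 : i₂ = k <;> simp [h1, h2] <;> ring
    · simp only [sign_neg (sub_neg.2 h), h, h.not_gt, if_true, if_false]
      by_cases h1 : i₁ = k <;> by_cases h2 : i₂ = k <;> simp [h1, h2] <;> ring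
  simp only [hpt, ← Finset.mul_sum, Finset.sum_add_distrib, Finset.sum_sub_distrib]
  have e1 : ∑ i₁ : Fin n, ∑ _i₂ : Fin n, δ i₁ = n := by
    rw [Finset.sum_comm]
    simp [δ]
  have e2 : ∑ _i₁ : Fin n, ∑ i₂ : Fin n, δ i₂ = n := by simp [δ]
  have e3 : ∑ i₁, ∑ i₂, sg i₁ i₂ * δ i₁ = n * bias x k := by
    rw [Finset.sum_comm, bias, mul_div_cancel₀ _ hn']
    simp [δ, sg]
  have e4 : ∑ i₁, ∑ i₂, sg i₁ i₂ * δ i₂ = -(n * bias x k) := by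
    rw [bias, mul_div_cancel₀ _ hn', ← Finset.sum_neg_distrib]
    refine Finset.sum_congr rfl fun j _ => ?_
    rw [← neg_sub (x k) (x j), Left.sign_neg]
    simp [δ, sg]
  simp only [Finset.sum_const, Finset.card_univ, Fintype.card_fin, nsmul_eq_mul] at e1 e2
  simp only [Finset.sum_const, Finset.card_univ, Fintype.card_fin, nsmul_eq_mul, e1, e2, e3, e4]
  field_simp
  ring

theorem allocLaw_chosenBin {n : ℕ} (hn : 0 < n) {β : ℝ} (hβ0 : 0 ≤ β) (hβ1 : β ≤ 1)
    (W : Measure ℝ) [IsProbabilityMeasure W] (x : Fin n → ℝ) :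
    AllocLaw (chosenBin x) Ball.weight (ballLaw n β W) (fun i => (1 + β * bias x i) / n) W := by
  intro F hF
  have hFm : Measurable fun q : Fin n × ℝ => F q.1 q.2 :=
    measurable_from_prod_countable_right hF
  have hm : Measurable fun e : Ball n => F (chosenBin x e) e.weight :=
    hFm.comp ((measurable_chosenBin.comp measurable_prodMk_left).prodMk measurable_weight)
  rw [ballLaw, lintegral_discreteLaw_prod _ _ hm]
  have h1 : ∀ i₁, Measurable fun e => F (chosenBin x (i₁, e)) (Ball.weight (i₁, e)) :=
    fun i₁ => hm.comp measurable_prodMk_left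
  have h2 : ∀ i₁ i₂, Measurable fun e => F (chosenBin x (i₁, i₂, e)) (Ball.weight (i₁, i₂, e)) :=
    fun i₁ i₂ => (h1 i₁).comp measurable_prodMk_left
  have h3 : ∀ i₁ i₂ d,
      Measurable fun e => F (chosenBin x (i₁, i₂, d, e)) (Ball.weight (i₁, i₂, d, e)) :=
    fun i₁ i₂ d => (h2 i₁ i₂).comp measurable_prodMk_left
  have hexpand : ∑ i₁, ENNReal.ofReal (1 / (n : ℝ)) *
      ∫⁻ e, F (chosenBin x (i₁, e)) (Ball.weight (i₁, e)) ∂((discreteLaw fun _ : Fin n =>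
        1 / (n : ℝ)).prod ((discreteLaw fun d : Bool => if d then β else 1 - β).prod
          ((discreteLaw fun _ : Bool => (1 / 2 : ℝ)).prod W))) =
      ∑ i₁, ENNReal.ofReal (1 / (n : ℝ)) * ∑ i₂, ENNReal.ofReal (1 / (n : ℝ)) *
        ∑ d : Bool, ENNReal.ofReal (if d then β else 1 - β) *
          ∑ t : Bool, ENNReal.ofReal (1 / 2) * ∫⁻ v, F (chosenBin x (i₁, i₂, d, t, v))
            (Ball.weight (i₁, i₂, d, t, v)) ∂W := by
    refine Finset.sum_congr rfl fun i₁ _ => ?_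
    rw [lintegral_discreteLaw_prod _ _ (h1 i₁)]
    refine congrArg _ (Finset.sum_congr rfl fun i₂ _ => ?_)
    rw [lintegral_discreteLaw_prod _ _ (h2 i₁ i₂)]
    refine congrArg _ (Finset.sum_congr rfl fun d _ => ?_)
    rw [lintegral_discreteLaw_prod _ _ (h3 i₁ i₂ d)]
  rw [hexpand]
  have hG : ∀ i₁ i₂ d t, ∫⁻ v, F (chosenBin x (i₁, i₂, d, t, v))
      (Ball.weight (i₁, i₂, d, t, v)) ∂W =
      ∑ k, if chosenBin x (i₁, i₂, d, t, 0) = k then ∫⁻ v, F k v ∂W else 0 := by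
    intro i₁ i₂ d t
    rw [Finset.sum_ite_eq, if_pos (Finset.mem_univ _)]
    rfl
  have hd : ∀ d : Bool, 0 ≤ if d then β else 1 - β := by
    intro d
    split_ifs <;> linarith
  have hn0 : (0 : ℝ) ≤ 1 / n := by positivity
  have hcoef : ∀ (i₁ i₂ : Fin n) (d t : Bool) (k : Fin n) (G : ENNReal),
      ENNReal.ofReal (1 / (n : ℝ)) * (ENNReal.ofReal (1 / (n : ℝ)) *
        (ENNReal.ofReal (if d then β else 1 - β) * (ENNReal.ofReal (1 / 2) *
          (if chosenBin x (i₁, i₂, d, t, 0) = k then G else 0)))) =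
      ENNReal.ofReal (if chosenBin x (i₁, i₂, d, t, 0) = k then
        1 / (n : ℝ) * (1 / (n : ℝ) * ((if d then β else 1 - β) * (1 / 2))) else 0) * G := by
    intro i₁ i₂ d t k G
    by_cases h : chosenBin x (i₁, i₂, d, t, 0) = k
    · simp only [h, if_true]
      rw [ENNReal.ofReal_mul hn0, ENNReal.ofReal_mul hn0, ENNReal.ofReal_mul (hd d)]
      ring
    · simp [h]
  simp only [hG, Finset.mul_sum, hcoef]
  have hpos : ∀ (i₁ i₂ : Fin n) (d t : Bool) (k : Fin n),
      0 ≤ if chosenBin x (i₁, i₂, d, t, 0) = k then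
        1 / (n : ℝ) * (1 / (n : ℝ) * ((if d then β else 1 - β) * (1 / 2))) else 0 := by
    intro i₁ i₂ d t k
    have := hd d
    refine ite_nonneg ?_ le_rfl
    positivity
  have hsum : ∀ k, ENNReal.ofReal ((1 + β * bias x k) / n) =
      ∑ i₁, ∑ i₂, ∑ d : Bool, ∑ t : Bool,
        ENNReal.ofReal (if chosenBin x (i₁, i₂, d, t, 0) = k then
          1 / (n : ℝ) * (1 / (n : ℝ) * ((if d then β else 1 - β) * (1 / 2))) else 0) := by
    intro k
    rw [← sum_chosenBin hn β x k, ENNReal.ofReal_sum_of_nonneg fun _ _ =>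
      Finset.sum_nonneg fun _ _ => Finset.sum_nonneg fun _ _ => Finset.sum_nonneg fun _ _ =>
        hpos _ _ _ _ _]
    refine Finset.sum_congr rfl fun i₁ _ => ?_
    rw [ENNReal.ofReal_sum_of_nonneg fun _ _ => Finset.sum_nonneg fun _ _ =>
      Finset.sum_nonneg fun _ _ => hpos _ _ _ _ _]
    refine Finset.sum_congr rfl fun i₂ _ => ?_
    rw [ENNReal.ofReal_sum_of_nonneg fun _ _ => Finset.sum_nonneg fun _ _ => hpos _ _ _ _ _]
    refine Finset.sum_congr rfl fun d _ => ?_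
    rw [ENNReal.ofReal_sum_of_nonneg fun _ _ => hpos _ _ _ _ _]
  simp only [hsum, Finset.sum_mul]
  symm
  rw [Finset.sum_comm]
  refine Finset.sum_congr rfl fun i₁ _ => ?_
  rw [Finset.sum_comm]
  refine Finset.sum_congr rfl fun i₂ _ => ?_
  rw [Finset.sum_comm]
  refine Finset.sum_congr rfl fun d _ => ?_
  rw [Finset.sum_comm]

/-! ### The process on the sorted loads -/

/-- The space splits into finitely many pieces according to the sorting permutation; each is cut out
by comparisons of coordinates, and sorting is a fixed permutation on it. -/
theorem measurable_sortDesc {n : ℕ} : Measurable (sortDesc : (Fin n → ℝ) → Fin n → ℝ) := by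
  have hs : ∀ σ : Equiv.Perm (Fin n), MeasurableSet {z : Fin n → ℝ | σ = Tuple.sort z} := by
    intro σ
    simp only [Tuple.eq_sort_iff, Monotone, Function.comp_apply, Set.ofPred_and, Set.ofPred_forall]
    refine (MeasurableSet.iInter fun i => MeasurableSet.iInter fun j =>
      MeasurableSet.iInter fun _ => measurableSet_le (by fun_prop) (by fun_prop)).inter
      (MeasurableSet.iInter fun i => MeasurableSet.iInter fun j =>
        MeasurableSet.iInter fun _ => ?_)
    by_cases h : σ i < σ j
    · simp [h]
    · simp only [h, imp_false]
      exact (measurableSet_eq_fun (by fun_prop) (by fun_prop)).compl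
  refine measurable_pi_lambda _ fun i => ?_
  have hrw : (fun z : Fin n → ℝ => sortDesc z i) =
      fun z => ∑ σ : Equiv.Perm (Fin n), if σ = Tuple.sort z then z (σ i.rev) else 0 := by
    funext z
    simp [sortDesc]
  rw [hrw]
  exact Finset.measurable_sum _ fun σ _ =>
    Measurable.ite (hs σ) (measurable_pi_apply _) measurable_const

theorem antitone_sortDesc {n : ℕ} (z : Fin n → ℝ) : Antitone (sortDesc z) :=
  fun _ _ hij => Tuple.monotone_sort z (Fin.rev_le_rev.2 hij)

theorem potential_sortDesc {n : ℕ} (γ : ℝ) (z : Fin n → ℝ) :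
    potential γ (sortDesc z) = potential γ z := by
  let e : Equiv.Perm (Fin n) := Fin.revPerm.trans (Tuple.sort z)
  have h1 : ∑ j, sortDesc z j = ∑ j, z j := Equiv.sum_comp e z
  simp only [potential, h1]
  exact Equiv.sum_comp e fun i => 2 * Real.cosh (γ * (z i - (∑ j, z j) / n))

theorem potential_sub_const {n : ℕ} (γ : ℝ) (z : Fin n → ℝ) (d : ℝ) :
    potential γ (fun i => z i - d) = potential γ z := by
  rcases Nat.eq_zero_or_pos n with rfl | hn
  · simp [potential]
  have hn' : (n : ℝ) ≠ 0 := by positivity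
  unfold potential
  refine Finset.sum_congr rfl fun i _ => ?_
  rw [Finset.sum_sub_distrib, Finset.sum_const, Finset.card_univ, Fintype.card_fin, nsmul_eq_mul,
    sub_div, mul_div_cancel_left₀ _ hn', sub_sub_sub_cancel_right]

/-- Rank `0` is the heaviest bin, so `-j` orders the ranks by load. It has no ties: `i` bins lie
above rank `i` and `n - 1 - i` below. -/
theorem bias_neg_index {n : ℕ} (i : Fin n) :
    bias (fun j : Fin n => -(j : ℝ)) i = (2 * (i : ℝ) + 1 - n) / n := by
  rw [bias]
  congr 1
  have hpt : ∀ j : Fin n, (SignType.sign (-(j : ℝ) - -(i : ℝ)) : ℝ) =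
      (if j < i then 1 else 0) - (if i < j then 1 else 0) := by
    intro j
    rcases lt_trichotomy j i with h | h | h
    · have h' : (j : ℝ) < i := by exact_mod_cast h
      rw [sign_pos (by linarith)]
      simp [h, h.not_gt]
    · simp [h]
    · have h' : (i : ℝ) < j := by exact_mod_cast h
      rw [sign_neg (by linarith)]
      simp [h, h.not_gt]
  simp only [hpt, Finset.sum_sub_distrib, Finset.sum_boole]
  have e1 : (Finset.univ.filter fun j => j < i) = Finset.Iio i := by ext; simp
  have e2 : (Finset.univ.filter fun j => i < j) = Finset.Ioi i := by ext; simp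
  rw [e1, e2, Fin.card_Iio, Fin.card_Ioi, Nat.sub_sub, Nat.cast_sub (by omega)]
  push_cast
  ring

theorem allocLaw_onePlusBetaVec {n : ℕ} (β : ℝ) (W : Measure ℝ) [IsProbabilityMeasure W] :
    AllocLaw Prod.fst Prod.snd ((discreteLaw (onePlusBetaVec n β)).prod W)
      (fun i => (1 + β * bias (fun j : Fin n => -(j : ℝ)) i) / n) W := by
  intro F hF
  have hFm : Measurable fun q : Fin n × ℝ => F q.1 q.2 :=
    measurable_from_prod_countable_right hF
  rw [lintegral_discreteLaw_prod _ _ hFm]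
  refine Finset.sum_congr rfl fun i _ => ?_
  congr 2
  have hn' : (n : ℝ) ≠ 0 := by
    have := i.pos
    positivity
  simp only [bias_neg_index, onePlusBetaVec]
  field_simp
  ring

end BatchedAlloc
end

/-! ### Both processes as instances of the general gap bound. -/

theorem corollary3p2 :
    ∃ k : ℝ, 0 < k ∧
      ∀ (n b : ℕ) (S β : ℝ) (W : Measure ℝ),
        1 ≤ n → (n : ℝ) * Real.log n ≤ b →
        1 ≤ S → S ≤ (b : ℝ) / (4 * n) →
        BatchedAlloc.FiniteMgf S W →
        β = √(4 * S * (n / b)) →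
        ∀ (Ω : Type*) [MeasurableSpace Ω] (P : Measure Ω) [IsProbabilityMeasure P],
          -- the process with random tie-breaking, driven by independent balls
          (∀ a : ℕ → Ω → BatchedAlloc.Ball n,
            iIndepFun a P → (∀ s, HasLaw (a s) (BatchedAlloc.ballLaw n β W) P) →
            ∀ r : ℕ,
              1 - 1 / (n : ℝ) ^ 2 ≤
                P.real {ω | BatchedAlloc.gap (BatchedAlloc.load b (fun s => a s ω) r) ≤
                  k * √(S * b / n) * Real.log n}) ∧
          -- the process given by its probability allocation vector on the sorted loads
          (∀ a : ℕ → Ω → Fin n × ℝ,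
            iIndepFun a P →
            (∀ s, HasLaw (a s)
              ((BatchedAlloc.discreteLaw (BatchedAlloc.onePlusBetaVec n β)).prod W) P) →
            ∀ r : ℕ,
              1 - 1 / (n : ℝ) ^ 2 ≤
                P.real {ω | BatchedAlloc.gap (BatchedAlloc.sortedLoad b (fun s => a s ω) r) ≤
                  k * √(S * b / n) * Real.log n}) := by
  open BatchedAlloc in
  refine ⟨504, by norm_num, ?_⟩
  intro n b S β W hn _ hS hSb hW hβ Ω _ P _
  have := hW.isProbabilityMeasure
  -- For `n = 1` the claimed lower bound on the probability is `0`.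
  rcases hn.eq_or_lt with rfl | hn2
  · constructor <;> intros <;> simp [measureReal_nonneg]
  have hn' : (0 : ℝ) < n := by positivity
  have hβ0 : 0 ≤ β := hβ ▸ Real.sqrt_nonneg _
  have hb : (0 : ℝ) < b := by
    have := (div_pos_iff_of_pos_right (by positivity)).1 ((zero_lt_one.trans_le hS).trans_le hSb)
    exact this
  have hβ1 : β ≤ 1 := by
    rw [hβ, Real.sqrt_le_one, ← mul_div_assoc, div_le_one hb]
    rw [le_div_iff₀ (by positivity)] at hSb
    linarith
  constructor
  · intro a hindep hlaw r
    refine one_sub_le_gap_le (I := Set.univ) (c := chosenBin) (w := Ball.weight) (L := load b)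
      (u := fun x e i => x i + ∑ j, if chosenBin x (e j) = i then (e j).weight else 0)
      hn2 hS hSb hW hβ measurable_weight (fun x => measurable_chosenBin.comp measurable_prodMk_left)
      ?_ (fun _ _ _ => rfl) trivial (fun _ _ _ => trivial)
      (fun x _ => ⟨x, ⟨fun _ _ h => h.le, fun _ _ h => h⟩,
        allocLaw_chosenBin hn hβ0 hβ1 W x⟩) (fun _ => rfl) ?_ hindep hlaw r
    · refine measurable_pi_lambda _ fun i => ?_
      refine ((measurable_pi_apply i).comp measurable_fst).add
        (Finset.measurable_sum _ fun j _ => ?_)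
      have he : Measurable fun p : (Fin n → ℝ) × (Fin b → Ball n) => p.2 j :=
        (measurable_pi_apply j).comp measurable_snd
      exact Measurable.ite ((measurable_chosenBin.comp (measurable_fst.prodMk he))
        (measurableSet_singleton i)) (measurable_weight.comp he) measurable_const
    · intro a r
      funext i
      simp only [load, Finset.sum_range]
  · intro a hindep hlaw r
    refine one_sub_le_gap_le (I := {x | Antitone x}) (c := fun _ => Prod.fst) (w := Prod.snd)
      (L := sortedLoad b)
      (u := fun x e => sortDesc fun i => x i + (∑ j, if (e j).1 = i then (e j).2 else 0)
        - 1 / (n : ℝ) * ∑ j, (e j).2)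
      hn2 hS hSb hW hβ measurable_snd (fun _ => measurable_fst) ?_ ?_ antitone_const
      (fun _ _ _ => antitone_sortDesc _)
      -- Here the invariant that the load vector is antitone makes minus the rank compatible with
      -- the loads; equal loads may have different ranks, but not conversely.
      (fun x hx => ⟨fun j => -(j : ℝ), ⟨fun i j h => hx ?_, fun i j h => ?_⟩,
        allocLaw_onePlusBetaVec β W⟩) (fun _ => rfl) ?_ hindep hlaw r
    · refine measurable_sortDesc.comp (measurable_pi_lambda _ fun i => ?_)
      have he : ∀ j, Measurable fun p : (Fin n → ℝ) × (Fin b → Fin n × ℝ) => p.2 j :=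
        fun j => (measurable_pi_apply j).comp measurable_snd
      refine (((measurable_pi_apply i).comp measurable_fst).add
        (Finset.measurable_sum _ fun j _ => ?_)).sub
        ((Finset.measurable_sum _ fun j _ => measurable_snd.comp (he j)).const_mul _)
      exact Measurable.ite ((measurable_fst.comp (he j)) (measurableSet_singleton i))
        (measurable_snd.comp (he j)) measurable_const
    · intro γ x e
      rw [potential_sortDesc, potential_sub_const]
    · have : (j : ℝ) < i := neg_lt_neg_iff.1 h
      exact_mod_cast this.le
    · have : (i : ℝ) = j := neg_inj.1 h
      rw [show i = j from Fin.ext (by exact_mod_cast this)]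
    · intro a r
      simp only [sortedLoad, Finset.sum_range]
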